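/- Let $\mathbb{C}$ be a category equipped with * a *sum structure* $\oplus$, i.e. a monoidal structure $(\oplus,0,\alpha_\oplus,\lambda_\oplus,\rho_\oplus)$ whose unit $0$ is initial and whose inclusions $\iota_1\colon X\cong X\oplus 0\to X\oplus Y$ and $\iota_2\colon Y\cong 0\oplus Y\to X\oplus Y$ are jointly epimorphic, and * a *product structure* $\otimes$, i.e. a monoidal structure $(\otimes,1,\alpha_\otimes,\lambda_\otimes,\rho_\otimes)$ whose unit $1$ is terminal and whose projections $\pi_1\colon X\otimes Y\to X\otimes 1\cong X$ and $\pi_2\colon X\otimes Y\to 1\otimes Y\cong Y$ are jointly monomorphic. Any natural transformation $i\colon\oplus\to\otimes$ makes $\mathbb{C}$ pointed, with zero object $0\cong 1$; write $z_{X,Y}\colon X\to 0\to Y$ for the zero morphism. Call $i$ a *lineariser* if it is a natural isomorphism and, for all $A,B$, $\pi_1 i_{A,B}\iota_1=1_A$, $\pi_1 i_{A,B}\iota_2=z_{B,A}$, $\pi_2 i_{A,B}\iota_1=z_{A,B}$ and $\pi_2 i_{A,B}\iota_2=1_B$. A *$\oplus\otimes$-word* is a formal expression built from the symbols $0$, $1$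 and a placeholder $\_$ by the binary operations $\oplus$ and $\otimes$; its *length* is the number of occurrences of $\_$. A word $w$ of length $n$ determines a functor $w_{\mathbb{C}}\colon\mathbb{C}^n\to\mathbb{C}$ by substituting the $k$-th entry for the $k$-th occurrence of $\_$. The natural transformations between (functors determined by) words that are *canonical with respect to $\oplus$ and $\otimes$* form the smallest class that contains $i$, $i^{-1}$, the unique morphism $j\colon 0\to 1$, identities, and the associators and unitors of $\oplus$ and of $\otimes$ and their inverses (all evaluated at arbitrary words), and that is closed under vertical composition, under $\oplus$ and under $\otimes$. A morphism $v_{\mathbb{C}}(\underline{X})\to w_{\mathbb{C}}(\underline{X})$ is canonical if it is the component at $\underline{X}$ of a canonical natural transformation from $v$ to $w$. **Theorem.** Suppose $\mathbb{C}$ is equipped with a lineariser $i\colon\oplus\to\otimes$. Then for any two $\oplus\otimes$-words $v,w$ of the same length $n$ there is a unique natural isomorphism $v_{\mathbb{C}}\cong w_{\mathbb{C}}$ that is canonical with respect to $\oplus$ and $\otimes$. Likewise, for every $n$-tuple $\underline{X}$ of objects of $\mathbb{C}$, there is a unique canonical isomorphism $v_{\mathbb{C}}(\underline{X})\cong w_{\mathbb{C}}(\underline{X})$.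 -/

import Mathlib

open CategoryTheory CategoryTheory.Limits MonoidalCategory

universe v u w

/-- A (monoidal) sum structure on a category `C`: a monoidal structure `(⊕, 0, α, λ, ρ)` whose unit
`0` is initial and whose binary inclusions `X ≅ X ⊕ 0 ⟶ X ⊕ Y` and `Y ≅ 0 ⊕ Y ⟶ X ⊕ Y` are jointly
epimorphic. -/
structure SumStructure (C : Type u) [Category.{v} C] where
  monoidal : MonoidalCategory C
  isInitial : IsInitial (𝟙_ C)
  jointly_epi : ∀ {X Y Z : C} (f g : X ⊗ Y ⟶ Z),
    ((ρ_ X).inv ≫ X ◁ isInitial.to Y) ≫ f = ((ρ_ X).inv ≫ X ◁ isInitial.to Y) ≫ g →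
    ((λ_ Y).inv ≫ isInitial.to X ▷ Y) ≫ f = ((λ_ Y).inv ≫ isInitial.to X ▷ Y) ≫ g → f = g

/-- A (monoidal) product structure on a category `C`: a monoidal structure `(⊗, 1, α, λ, ρ)` whose
unit `1` is terminal and whose binary projections `X ⊗ Y ⟶ X ⊗ 1 ≅ X` and `X ⊗ Y ⟶ 1 ⊗ Y ≅ Y` are
jointly monomorphic. -/
structure ProductStructure (C : Type u) [Category.{v} C] where
  monoidal : MonoidalCategory C
  isTerminal : IsTerminal (𝟙_ C)
  jointly_mono : ∀ {X Y Z : C} (f g : Z ⟶ X ⊗ Y),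
    f ≫ (X ◁ isTerminal.from Y ≫ (ρ_ X).hom) = g ≫ (X ◁ isTerminal.from Y ≫ (ρ_ X).hom) →
    f ≫ (isTerminal.from X ▷ Y ≫ (λ_ Y).hom) = g ≫ (isTerminal.from X ▷ Y ≫ (λ_ Y).hom) → f = g

namespace SumStructure

variable {C : Type u} [Category.{v} C] (S : SumStructure C)

/-- The unit object `0`. -/
abbrev zero : C := letI := S.monoidal; 𝟙_ C

/-- The object `X ⊕ Y`. -/
abbrev obj (X Y : C) : C := letI := S.monoidal; X ⊗ Y

/-- The functor `⊕ : C × C ⥤ C`. -/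
abbrev functor : C × C ⥤ C := letI := S.monoidal; tensor C

/-- The first inclusion `X ⟶ X ⊕ Y`. -/
abbrev ι₁ (X Y : C) : X ⟶ S.obj X Y := letI := S.monoidal; (ρ_ X).inv ≫ X ◁ S.isInitial.to Y

/-- The second inclusion `Y ⟶ X ⊕ Y`. -/
abbrev ι₂ (X Y : C) : Y ⟶ S.obj X Y := letI := S.monoidal; (λ_ Y).inv ≫ S.isInitial.to X ▷ Y

end SumStructure

namespace ProductStructure

variable {C : Type u} [Category.{v} C] (P : ProductStructure C)

/-- The unit object `1`. -/
abbrev one : C := letI := P.monoidal; 𝟙_ C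

/-- The object `X ⊗ Y`. -/
abbrev obj (X Y : C) : C := letI := P.monoidal; X ⊗ Y

/-- The functor `⊗ : C × C ⥤ C`. -/
abbrev functor : C × C ⥤ C := letI := P.monoidal; tensor C

/-- The first projection `X ⊗ Y ⟶ X`. -/
abbrev π₁ (X Y : C) : P.obj X Y ⟶ X := letI := P.monoidal; X ◁ P.isTerminal.from Y ≫ (ρ_ X).hom

/-- The second projection `X ⊗ Y ⟶ Y`. -/
abbrev π₂ (X Y : C) : P.obj X Y ⟶ Y := letI := P.monoidal; P.isTerminal.from X ▷ Y ≫ (λ_ Y).hom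

end ProductStructure

section Linearisers

variable {C : Type u} [Category.{v} C] {S : SumStructure C} {P : ProductStructure C}

/-- The composite `1 ≅ 1 ⊕ 0 ⟶ 1 ⊗ 0 ≅ 0` attached to a natural transformation `⊕ ⟶ ⊗`. -/
def oneToZero (i : S.functor ⟶ P.functor) : P.one ⟶ S.zero :=
  (letI := S.monoidal; (ρ_ P.one).inv) ≫ i.app (P.one, S.zero) ≫
    (letI := P.monoidal; (λ_ S.zero).hom)

/-- A category with a natural transformation `⊕ ⟶ ⊗` is pointed: `0` is a zero object. -/
theorem isZero_zero (i : S.functor ⟶ P.functor) : IsZero S.zero where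
  unique_to Y := ⟨⟨⟨S.isInitial.to Y⟩, fun _ => S.isInitial.hom_ext _ _⟩⟩
  unique_from X := ⟨⟨⟨P.isTerminal.from X ≫ oneToZero i⟩, fun f => by
    have h : S.isInitial.to P.one ≫ oneToZero i = 𝟙 S.zero := S.isInitial.hom_ext _ _
    have h' : f ≫ S.isInitial.to P.one = P.isTerminal.from X := P.isTerminal.hom_ext _ _
    change f = P.isTerminal.from X ≫ oneToZero i
    rw [← h', Category.assoc, h, Category.comp_id]⟩⟩

/-- The zero morphism `X ⟶ 0 ⟶ Y`. -/
noncomputable def zeroMap (i : S.functor ⟶ P.functor) (X Y : C) : X ⟶ Y :=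
  (isZero_zero i).from_ X ≫ (isZero_zero i).to_ Y

variable (S P)

/-- A prelineariser: a natural transformation `i : ⊕ ⟶ ⊗` all of whose components have the identity
matrix as matrix presentation. -/
structure Prelineariser where
  i : S.functor ⟶ P.functor
  ι₁_π₁ : ∀ A B : C, S.ι₁ A B ≫ i.app (A, B) ≫ P.π₁ A B = 𝟙 A
  ι₂_π₁ : ∀ A B : C, S.ι₂ A B ≫ i.app (A, B) ≫ P.π₁ A B = zeroMap i B A
  ι₁_π₂ : ∀ A B : C, S.ι₁ A B ≫ i.app (A, B) ≫ P.π₂ A B = zeroMap i A B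
  ι₂_π₂ : ∀ A B : C, S.ι₂ A B ≫ i.app (A, B) ≫ P.π₂ A B = 𝟙 B

/-- A lineariser: a prelineariser which is an isomorphism `⊕ ≅ ⊗`. -/
structure Lineariser extends Prelineariser S P where
  isIso : IsIso i

end Linearisers

/-- Words built from the units `0` and `1` and from letters in `ι` by means of `⊕` and `⊗`. -/
inductive Word (ι : Type w) : Type w
  | var (x : ι) : Word ι
  | zero : Word ι
  | one : Word ι
  | sum (a b : Word ι) : Word ι
  | prod (a b : Word ι) : Word ι

/-- A `⊕⊗`-word: every letter is the placeholder `_`. -/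
abbrev SumProdWord : Type := Word Unit

namespace SumProdWord

/-- The length of a word: the number of occurrences of `_`. -/
def length : SumProdWord → ℕ
  | .var _ => 1
  | .zero => 0
  | .one => 0
  | .sum a b => length a + length b
  | .prod a b => length a + length b

/-- Replace the `k`-th occurrence (from the left) of `_` by the letter `x k`. -/
def fill {ι : Type w} : (a : SumProdWord) → (Fin (length a) → ι) → Word ι
  | .var _, x => .var (x (0 : Fin 1))
  | .zero, _ => .zero
  | .one, _ => .one
  | .sum a b, x =>
      .sum (fill a fun k => x (Fin.castAdd (length b) k)) (fill b fun k => x (Fin.natAdd (length a) k))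
  | .prod a b, x =>
      .prod (fill a fun k => x (Fin.castAdd (length b) k)) (fill b fun k => x (Fin.natAdd (length a) k))

/-- A word of length `n`, its placeholders numbered `0, …, n - 1` from left to right. -/
def numbered (a : SumProdWord) {n : ℕ} (h : length a = n) : Word (Fin n) :=
  fill a (Fin.cast h)

end SumProdWord

section Canonical

variable {C : Type u} [Category.{v} C] (S : SumStructure C) (P : ProductStructure C)

/-- The functor `C^ι ⥤ C` determined by a word in the letters `ι`: substitute for each letter `x` the
`x`-th entry. Here `⊕` and `⊗` of functors are formed pointwise, by Mathlib's monoidal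
structure on a category of functors into a monoidal category. -/
def Word.toFunctor {ι : Type w} : Word ι → ((ι → C) ⥤ C)
  | .var x => Pi.eval (fun _ : ι => C) x
  | .zero => (Functor.const (ι → C)).obj S.zero
  | .one => (Functor.const (ι → C)).obj P.one
  | .sum a b => letI := S.monoidal; a.toFunctor ⊗ b.toFunctor
  | .prod a b => letI := P.monoidal; a.toFunctor ⊗ b.toFunctor

/-- The functor `w_C : Cⁿ ⥤ C` determined by a `⊕⊗`-word `w` of length `n`. -/
abbrev SumProdWord.toFunctor (a : SumProdWord) {n : ℕ} (h : SumProdWord.length a = n) :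
    (Fin n → C) ⥤ C :=
  Word.toFunctor S P (a.numbered h)

variable {S P}

/-- The morphism `j : 0 ⟶ 1`, as a transformation of constant functors. -/
def constJ (S : SumStructure C) (P : ProductStructure C) (ι : Type w) :
    Word.toFunctor S P (Word.zero : Word ι) ⟶ Word.toFunctor S P Word.one :=
  (Functor.const (ι → C)).map (S.isInitial.to P.one)

/-- The transformation `i` evaluated at two words, with components
`i_{a(X), b(X)} : a(X) ⊕ b(X) ⟶ a(X) ⊗ b(X)`. -/
def wordI (i : S.functor ⟶ P.functor) {ι : Type w} (a b : Word ι) :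
    Word.toFunctor S P (.sum a b) ⟶ Word.toFunctor S P (.prod a b) :=
  Functor.whiskerLeft ((a.toFunctor S P).prod' (b.toFunctor S P)) i

/-- The transformation `i⁻¹` evaluated at two words, with components
`i_{a(X), b(X)}⁻¹ : a(X) ⊗ b(X) ⟶ a(X) ⊕ b(X)`. -/
noncomputable def wordIInv (i : S.functor ⟶ P.functor) [IsIso i] {ι : Type w} (a b : Word ι) :
    Word.toFunctor S P (.prod a b) ⟶ Word.toFunctor S P (.sum a b) :=
  Functor.whiskerLeft ((a.toFunctor S P).prod' (b.toFunctor S P)) (inv i)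

/-- The natural transformations between words that are canonical with respect to `⊕` and `⊗`, for a
lineariser `i : ⊕ ≅ ⊗`: those obtained from `i`, `i⁻¹`, `j : 0 ⟶ 1`, identities, and the associators
and unitors of `⊕` and `⊗` and their inverses, all evaluated at arbitrary words, by vertical
composition, `⊕` and `⊗`. (The morphism `1 ⟶ 0` inverse to `j` is `1 ≅ 1 ⊕ 0 ⟶ 1 ⊗ 0 ≅ 0`, so needs no
clause.) -/
inductive Lineariser.IsCanonical (L : Lineariser S P) {ι : Type w} :
    (a b : Word ι) → (a.toFunctor S P ⟶ b.toFunctor S P) → Prop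
  | i (a b : Word ι) : L.IsCanonical (.sum a b) (.prod a b) (wordI L.i a b)
  | i_inv (a b : Word ι) : L.IsCanonical (.prod a b) (.sum a b)
      (letI := L.isIso; wordIInv L.i a b)
  | j : L.IsCanonical .zero .one (constJ S P ι)
  | id (a : Word ι) : L.IsCanonical a a (𝟙 _)
  | sum_α_hom (a b c : Word ι) : L.IsCanonical (.sum (.sum a b) c) (.sum a (.sum b c))
      (letI := S.monoidal; (α_ (a.toFunctor S P) (b.toFunctor S P) (c.toFunctor S P)).hom)
  | sum_α_inv (a b c : Word ι) : L.IsCanonical (.sum a (.sum b c)) (.sum (.sum a b) c)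
      (letI := S.monoidal; (α_ (a.toFunctor S P) (b.toFunctor S P) (c.toFunctor S P)).inv)
  | sum_lam_hom (a : Word ι) : L.IsCanonical (.sum .zero a) a
      (letI := S.monoidal; (λ_ (a.toFunctor S P)).hom)
  | sum_lam_inv (a : Word ι) : L.IsCanonical a (.sum .zero a)
      (letI := S.monoidal; (λ_ (a.toFunctor S P)).inv)
  | sum_ρ_hom (a : Word ι) : L.IsCanonical (.sum a .zero) a
      (letI := S.monoidal; (ρ_ (a.toFunctor S P)).hom)
  | sum_ρ_inv (a : Word ι) : L.IsCanonical a (.sum a .zero)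
      (letI := S.monoidal; (ρ_ (a.toFunctor S P)).inv)
  | prod_α_hom (a b c : Word ι) : L.IsCanonical (.prod (.prod a b) c) (.prod a (.prod b c))
      (letI := P.monoidal; (α_ (a.toFunctor S P) (b.toFunctor S P) (c.toFunctor S P)).hom)
  | prod_α_inv (a b c : Word ι) : L.IsCanonical (.prod a (.prod b c)) (.prod (.prod a b) c)
      (letI := P.monoidal; (α_ (a.toFunctor S P) (b.toFunctor S P) (c.toFunctor S P)).inv)
  | prod_lam_hom (a : Word ι) : L.IsCanonical (.prod .one a) a
      (letI := P.monoidal; (λ_ (a.toFunctor S P)).hom)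
  | prod_lam_inv (a : Word ι) : L.IsCanonical a (.prod .one a)
      (letI := P.monoidal; (λ_ (a.toFunctor S P)).inv)
  | prod_ρ_hom (a : Word ι) : L.IsCanonical (.prod a .one) a
      (letI := P.monoidal; (ρ_ (a.toFunctor S P)).hom)
  | prod_ρ_inv (a : Word ι) : L.IsCanonical a (.prod a .one)
      (letI := P.monoidal; (ρ_ (a.toFunctor S P)).inv)
  | comp {a b c : Word ι} {γ : a.toFunctor S P ⟶ b.toFunctor S P}
      {β : b.toFunctor S P ⟶ c.toFunctor S P} :
      L.IsCanonical a b γ → L.IsCanonical b c β → L.IsCanonical a c (γ ≫ β)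
  | sum {a a' b b' : Word ι} {β : a.toFunctor S P ⟶ a'.toFunctor S P}
      {γ : b.toFunctor S P ⟶ b'.toFunctor S P} :
      L.IsCanonical a a' β → L.IsCanonical b b' γ →
      L.IsCanonical (.sum a b) (.sum a' b') (letI := S.monoidal; β ⊗ₘ γ)
  | prod {a a' b b' : Word ι} {β : a.toFunctor S P ⟶ a'.toFunctor S P}
      {γ : b.toFunctor S P ⟶ b'.toFunctor S P} :
      L.IsCanonical a a' β → L.IsCanonical b b' γ →
      L.IsCanonical (.prod a b) (.prod a' b') (letI := P.monoidal; β ⊗ₘ γ)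

end Canonical

/-!
Every letter of a word `a` comes with an inclusion of the corresponding object into `a(X)`: for `⊕`
these are built from `ι₁` and `ι₂`, for `⊗` from `κ₁ = i ∘ ι₁` and `κ₂ = i ∘ ι₂`. Reading them from
left to right gives the list `Word.incl`.

*Uniqueness.* The inclusions are jointly epimorphic (`Word.incl_jointlyEpi`), and a canonical
transformation `a ⟶ b` carries the list of `a` to the list of `b`
(`Lineariser.IsCanonical.mapComp_incl`); hence any two canonical transformations `a ⟶ b` agree on every
component. For the generators attached to `⊕` the second claim is formal. For those attached to `⊗`
it uses that `i` has identity matrices: `κ₁, κ₂` are dual to the projections `π₁, π₂`, and the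
projections are jointly monomorphic and compatible with the associator of `⊗`.

*Existence.* Every word is canonically isomorphic to the right-bracketed sum `Word.ofList` of the
list of its letters (`Lineariser.CanonicallyIso.ofList_letters`), since `i` turns products into sums
and `1 ≅ 1 ⊕ 0 ≅ 1 ⊗ 0 ≅ 0`. Numbered words of the same length have the same list of letters.
-/

/-! ### Monoidal categories with initial or terminal unit -/

section UnitInitial

variable {C : Type u} [Category.{v} C] [MonoidalCategory C] (h : IsInitial (𝟙_ C))

theorem inclLeft_tensorHom {A A' B B' : C} (f : A ⟶ A') (g : B ⟶ B') :
    ((ρ_ A).inv ≫ A ◁ h.to B) ≫ (f ⊗ₘ g) = f ≫ (ρ_ A').inv ≫ A' ◁ h.to B' := by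
  -- `IsInitial.to_comp` would undo the factorisation of `h.to B'` introduced here.
  rw [MonoidalCategory.tensorHom_def, ← h.hom_ext (h.to B ≫ g) (h.to B')]
  simp [whisker_exchange_assoc, -IsInitial.to_comp]

theorem inclRight_tensorHom {A A' B B' : C} (f : A ⟶ A') (g : B ⟶ B') :
    ((λ_ B).inv ≫ h.to A ▷ B) ≫ (f ⊗ₘ g) = g ≫ (λ_ B').inv ≫ h.to A' ▷ B' := by
  rw [MonoidalCategory.tensorHom_def', ← h.hom_ext (h.to A ≫ f) (h.to A')]
  simp [← whisker_exchange_assoc, -IsInitial.to_comp]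

theorem inclLeft_inclLeft_associator (A B D : C) :
    ((ρ_ A).inv ≫ A ◁ h.to B) ≫ ((ρ_ (A ⊗ B)).inv ≫ (A ⊗ B) ◁ h.to D) ≫ (α_ A B D).hom =
      (ρ_ A).inv ≫ A ◁ h.to (B ⊗ D) := by
  rw [h.hom_ext (h.to (B ⊗ D)) (h.to B ≫ (ρ_ B).inv ≫ B ◁ h.to D)]
  simp [-IsInitial.to_comp]

theorem inclRight_inclLeft_associator (A B D : C) :
    ((λ_ B).inv ≫ h.to A ▷ B) ≫ ((ρ_ (A ⊗ B)).inv ≫ (A ⊗ B) ◁ h.to D) ≫ (α_ A B D).hom =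
      ((ρ_ B).inv ≫ B ◁ h.to D) ≫ (λ_ (B ⊗ D)).inv ≫ h.to A ▷ (B ⊗ D) := by
  have e : ((ρ_ (A ⊗ B)).inv ≫ (A ⊗ B) ◁ h.to D) ≫ (α_ A B D).hom =
      A ◁ ((ρ_ B).inv ≫ B ◁ h.to D) := by simp
  rw [e, Category.assoc, ← whisker_exchange, ← leftUnitor_inv_naturality_assoc]

theorem inclRight_associator (A B D : C) :
    ((λ_ D).inv ≫ h.to (A ⊗ B) ▷ D) ≫ (α_ A B D).hom =
      ((λ_ D).inv ≫ h.to B ▷ D) ≫ (λ_ (B ⊗ D)).inv ≫ h.to A ▷ (B ⊗ D) := by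
  rw [h.hom_ext (h.to (A ⊗ B)) (h.to B ≫ (λ_ B).inv ≫ h.to A ▷ B)]
  simp [-IsInitial.to_comp]

theorem inclLeft_rightUnitor (A : C) :
    ((ρ_ A).inv ≫ A ◁ h.to (𝟙_ C)) ≫ (ρ_ A).hom = 𝟙 A := by
  simp

theorem inclRight_leftUnitor (A : C) :
    ((λ_ A).inv ≫ h.to (𝟙_ C) ▷ A) ≫ (λ_ A).hom = 𝟙 A := by
  simp

end UnitInitial

section UnitTerminal

variable {C : Type u} [Category.{v} C] [MonoidalCategory C] (h : IsTerminal (𝟙_ C))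

theorem associator_projLeft (A B D : C) :
    (α_ A B D).hom ≫ A ◁ h.from (B ⊗ D) ≫ (ρ_ A).hom =
      ((A ⊗ B) ◁ h.from D ≫ (ρ_ (A ⊗ B)).hom) ≫ A ◁ h.from B ≫ (ρ_ A).hom := by
  rw [h.hom_ext (h.from (B ⊗ D)) ((B ◁ h.from D ≫ (ρ_ B).hom) ≫ h.from B)]
  simp [-IsTerminal.comp_from]

theorem associator_projRight_projLeft (A B D : C) :
    (α_ A B D).hom ≫ (h.from A ▷ (B ⊗ D) ≫ (λ_ (B ⊗ D)).hom) ≫ B ◁ h.from D ≫ (ρ_ B).hom =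
      ((A ⊗ B) ◁ h.from D ≫ (ρ_ (A ⊗ B)).hom) ≫ h.from A ▷ B ≫ (λ_ B).hom := by
  have e : (A ⊗ B) ◁ h.from D ≫ (ρ_ (A ⊗ B)).hom =
      (α_ A B D).hom ≫ A ◁ (B ◁ h.from D ≫ (ρ_ B).hom) := by simp
  rw [e, Category.assoc, Category.assoc, whisker_exchange_assoc, leftUnitor_naturality]

theorem associator_projRight_projRight (A B D : C) :
    (α_ A B D).hom ≫ (h.from A ▷ (B ⊗ D) ≫ (λ_ (B ⊗ D)).hom) ≫ h.from B ▷ D ≫ (λ_ D).hom =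
      h.from (A ⊗ B) ▷ D ≫ (λ_ D).hom := by
  rw [h.hom_ext (h.from (A ⊗ B)) ((h.from A ▷ B ≫ (λ_ B).hom) ≫ h.from B)]
  simp [-IsTerminal.comp_from]

theorem rightUnitor_eq_projLeft (A : C) :
    (ρ_ A).hom = A ◁ h.from (𝟙_ C) ≫ (ρ_ A).hom := by
  simp

theorem leftUnitor_eq_projRight (A : C) :
    (λ_ A).hom = h.from (𝟙_ C) ▷ A ≫ (λ_ A).hom := by
  simp

end UnitTerminal

/-! ### Inclusions and projections of monoidal sums and products -/

namespace SumStructure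

variable {C : Type u} [Category.{v} C] (S : SumStructure C)

theorem ι₁_tensorHom {A A' B B' : C} (f : A ⟶ A') (g : B ⟶ B') :
    S.ι₁ A B ≫ (letI := S.monoidal; f ⊗ₘ g) = f ≫ S.ι₁ A' B' :=
  letI := S.monoidal; inclLeft_tensorHom S.isInitial f g

theorem ι₂_tensorHom {A A' B B' : C} (f : A ⟶ A') (g : B ⟶ B') :
    S.ι₂ A B ≫ (letI := S.monoidal; f ⊗ₘ g) = g ≫ S.ι₂ A' B' :=
  letI := S.monoidal; inclRight_tensorHom S.isInitial f g

theorem ι₁_ι₁_associator (A B D : C) :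
    (S.ι₁ A B ≫ S.ι₁ (S.obj A B) D) ≫ (letI := S.monoidal; (α_ A B D).hom) =
      S.ι₁ A (S.obj B D) :=
  letI := S.monoidal; (Category.assoc _ _ _).trans (inclLeft_inclLeft_associator S.isInitial A B D)

theorem ι₂_ι₁_associator (A B D : C) :
    (S.ι₂ A B ≫ S.ι₁ (S.obj A B) D) ≫ (letI := S.monoidal; (α_ A B D).hom) =
      S.ι₁ B D ≫ S.ι₂ A (S.obj B D) :=
  letI := S.monoidal; (Category.assoc _ _ _).trans (inclRight_inclLeft_associator S.isInitial A B D)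

theorem ι₂_associator (A B D : C) :
    S.ι₂ (S.obj A B) D ≫ (letI := S.monoidal; (α_ A B D).hom) =
      S.ι₂ B D ≫ S.ι₂ A (S.obj B D) :=
  letI := S.monoidal; inclRight_associator S.isInitial A B D

theorem ι₁_rightUnitor (A : C) :
    S.ι₁ A S.zero ≫ (letI := S.monoidal; (ρ_ A).hom) = 𝟙 A :=
  letI := S.monoidal; inclLeft_rightUnitor S.isInitial A

theorem ι₂_leftUnitor (A : C) :
    S.ι₂ S.zero A ≫ (letI := S.monoidal; (λ_ A).hom) = 𝟙 A :=
  letI := S.monoidal; inclRight_leftUnitor S.isInitial A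

end SumStructure

namespace ProductStructure

variable {C : Type u} [Category.{v} C] (P : ProductStructure C)

theorem associator_π₁ (A B D : C) :
    (letI := P.monoidal; (α_ A B D).hom) ≫ P.π₁ A (P.obj B D) =
      P.π₁ (P.obj A B) D ≫ P.π₁ A B :=
  letI := P.monoidal; associator_projLeft P.isTerminal A B D

theorem associator_π₂_π₁ (A B D : C) :
    (letI := P.monoidal; (α_ A B D).hom) ≫ P.π₂ A (P.obj B D) ≫ P.π₁ B D =
      P.π₁ (P.obj A B) D ≫ P.π₂ A B :=
  letI := P.monoidal; associator_projRight_projLeft P.isTerminal A B D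

theorem associator_π₂_π₂ (A B D : C) :
    (letI := P.monoidal; (α_ A B D).hom) ≫ P.π₂ A (P.obj B D) ≫ P.π₂ B D =
      P.π₂ (P.obj A B) D :=
  letI := P.monoidal; associator_projRight_projRight P.isTerminal A B D

theorem rightUnitor_eq_π₁ (A : C) :
    (letI := P.monoidal; (ρ_ A).hom) = P.π₁ A P.one :=
  letI := P.monoidal; rightUnitor_eq_projLeft P.isTerminal A

theorem leftUnitor_eq_π₂ (A : C) :
    (letI := P.monoidal; (λ_ A).hom) = P.π₂ P.one A :=
  letI := P.monoidal; leftUnitor_eq_projRight P.isTerminal A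

/-- A morphism into a triple product `A ⊗ (B ⊗ D)` is determined by its three projections. -/
theorem hom_ext₃ {Z A B D : C} {f g : Z ⟶ P.obj A (P.obj B D)}
    (h₁ : f ≫ P.π₁ A (P.obj B D) = g ≫ P.π₁ A (P.obj B D))
    (h₂ : f ≫ P.π₂ A (P.obj B D) ≫ P.π₁ B D = g ≫ P.π₂ A (P.obj B D) ≫ P.π₁ B D)
    (h₃ : f ≫ P.π₂ A (P.obj B D) ≫ P.π₂ B D = g ≫ P.π₂ A (P.obj B D) ≫ P.π₂ B D) :
    f = g :=
  P.jointly_mono f g h₁ (P.jointly_mono _ _ (by simpa only [Category.assoc] using h₂)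
    (by simpa only [Category.assoc] using h₃))

end ProductStructure

/-! ### Inclusions into the product of a linearised category -/

section ZeroMap

variable {C : Type u} [Category.{v} C] {S : SumStructure C} {P : ProductStructure C}

theorem comp_zeroMap (i : S.functor ⟶ P.functor) {X Y Z : C} (f : X ⟶ Y) :
    f ≫ zeroMap i Y Z = zeroMap i X Z := by
  unfold zeroMap
  rw [← Category.assoc]
  congr 1
  exact (isZero_zero i).eq_of_tgt _ _

theorem zeroMap_comp (i : S.functor ⟶ P.functor) {X Y Z : C} (f : Y ⟶ Z) :
    zeroMap i X Y ≫ f = zeroMap i X Z := by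
  unfold zeroMap
  rw [Category.assoc]
  congr 1
  exact (isZero_zero i).eq_of_src _ _

end ZeroMap

namespace Prelineariser

variable {C : Type u} [Category.{v} C] {S : SumStructure C} {P : ProductStructure C}
  (L : Prelineariser S P)

/-- The first inclusion `A ⟶ A ⊕ B ⟶ A ⊗ B` into the product. -/
def κ₁ (A B : C) : A ⟶ P.obj A B := S.ι₁ A B ≫ L.i.app (A, B)

/-- The second inclusion `B ⟶ A ⊕ B ⟶ A ⊗ B` into the product. -/
def κ₂ (A B : C) : B ⟶ P.obj A B := S.ι₂ A B ≫ L.i.app (A, B)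

theorem κ₁_π₁ (A B : C) : L.κ₁ A B ≫ P.π₁ A B = 𝟙 A :=
  (Category.assoc _ _ _).trans (L.ι₁_π₁ A B)

theorem κ₂_π₁ (A B : C) : L.κ₂ A B ≫ P.π₁ A B = zeroMap L.i B A :=
  (Category.assoc _ _ _).trans (L.ι₂_π₁ A B)

theorem κ₁_π₂ (A B : C) : L.κ₁ A B ≫ P.π₂ A B = zeroMap L.i A B :=
  (Category.assoc _ _ _).trans (L.ι₁_π₂ A B)

theorem κ₂_π₂ (A B : C) : L.κ₂ A B ≫ P.π₂ A B = 𝟙 B :=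
  (Category.assoc _ _ _).trans (L.ι₂_π₂ A B)

theorem κ₁_π₁_assoc {A B Z : C} (f : A ⟶ Z) : L.κ₁ A B ≫ P.π₁ A B ≫ f = f := by
  rw [← Category.assoc, κ₁_π₁, Category.id_comp]

theorem κ₂_π₁_assoc {A B Z : C} (f : A ⟶ Z) :
    L.κ₂ A B ≫ P.π₁ A B ≫ f = zeroMap L.i B Z := by
  rw [← Category.assoc, κ₂_π₁, zeroMap_comp]

theorem κ₁_π₂_assoc {A B Z : C} (f : B ⟶ Z) :
    L.κ₁ A B ≫ P.π₂ A B ≫ f = zeroMap L.i A Z := by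
  rw [← Category.assoc, κ₁_π₂, zeroMap_comp]

theorem κ₂_π₂_assoc {A B Z : C} (f : B ⟶ Z) : L.κ₂ A B ≫ P.π₂ A B ≫ f = f := by
  rw [← Category.assoc, κ₂_π₂, Category.id_comp]

theorem κ₁_tensorHom {A A' B B' : C} (f : A ⟶ A') (g : B ⟶ B') :
    L.κ₁ A B ≫ (letI := P.monoidal; f ⊗ₘ g) = f ≫ L.κ₁ A' B' := by
  have h : (letI := S.monoidal; f ⊗ₘ g) ≫ L.i.app (A', B') =
      L.i.app (A, B) ≫ (letI := P.monoidal; f ⊗ₘ g) :=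
    L.i.naturality (X := (A, B)) (Y := (A', B')) (f, g)
  rw [κ₁, κ₁, Category.assoc, ← h, ← Category.assoc, S.ι₁_tensorHom, Category.assoc]

theorem κ₂_tensorHom {A A' B B' : C} (f : A ⟶ A') (g : B ⟶ B') :
    L.κ₂ A B ≫ (letI := P.monoidal; f ⊗ₘ g) = g ≫ L.κ₂ A' B' := by
  have h : (letI := S.monoidal; f ⊗ₘ g) ≫ L.i.app (A', B') =
      L.i.app (A, B) ≫ (letI := P.monoidal; f ⊗ₘ g) :=
    L.i.naturality (X := (A, B)) (Y := (A', B')) (f, g)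
  rw [κ₂, κ₂, Category.assoc, ← h, ← Category.assoc, S.ι₂_tensorHom, Category.assoc]

/-- The associator of `⊗` is described by its projections, so its effect on the inclusions `κ₁, κ₂` is
found by comparing all three projections; the zero entries in the matrix of `i` are needed here. -/
theorem κ₁_κ₁_associator (A B D : C) :
    L.κ₁ A B ≫ L.κ₁ (P.obj A B) D ≫ (letI := P.monoidal; (α_ A B D).hom) =
      L.κ₁ A (P.obj B D) := by
  apply P.hom_ext₃
  · rw [Category.assoc, Category.assoc, P.associator_π₁, κ₁_π₁_assoc, κ₁_π₁, κ₁_π₁]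
  · rw [Category.assoc, Category.assoc, P.associator_π₂_π₁, κ₁_π₁_assoc, κ₁_π₂, κ₁_π₂_assoc]
  · rw [Category.assoc, Category.assoc, P.associator_π₂_π₂, κ₁_π₂, comp_zeroMap, κ₁_π₂_assoc]

theorem κ₂_κ₁_associator (A B D : C) :
    L.κ₂ A B ≫ L.κ₁ (P.obj A B) D ≫ (letI := P.monoidal; (α_ A B D).hom) =
      L.κ₁ B D ≫ L.κ₂ A (P.obj B D) := by
  apply P.hom_ext₃
  · rw [Category.assoc, Category.assoc, P.associator_π₁, κ₁_π₁_assoc, κ₂_π₁, Category.assoc,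
      κ₂_π₁, comp_zeroMap]
  · rw [Category.assoc, Category.assoc, P.associator_π₂_π₁, κ₁_π₁_assoc, κ₂_π₂, Category.assoc,
      κ₂_π₂_assoc, κ₁_π₁]
  · rw [Category.assoc, Category.assoc, P.associator_π₂_π₂, κ₁_π₂, comp_zeroMap,
      Category.assoc, κ₂_π₂_assoc, κ₁_π₂]

theorem κ₂_associator (A B D : C) :
    L.κ₂ (P.obj A B) D ≫ (letI := P.monoidal; (α_ A B D).hom) =
      L.κ₂ B D ≫ L.κ₂ A (P.obj B D) := by
  apply P.hom_ext₃
  · rw [Category.assoc, P.associator_π₁, κ₂_π₁_assoc, Category.assoc, κ₂_π₁,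
      comp_zeroMap]
  · rw [Category.assoc, P.associator_π₂_π₁, κ₂_π₁_assoc, Category.assoc, κ₂_π₂_assoc, κ₂_π₁]
  · rw [Category.assoc, P.associator_π₂_π₂, κ₂_π₂, Category.assoc, κ₂_π₂_assoc, κ₂_π₂]

theorem κ₁_rightUnitor (A : C) :
    L.κ₁ A P.one ≫ (letI := P.monoidal; (ρ_ A).hom) = 𝟙 A := by
  rw [P.rightUnitor_eq_π₁, κ₁_π₁]

theorem κ₂_leftUnitor (A : C) :
    L.κ₂ P.one A ≫ (letI := P.monoidal; (λ_ A).hom) = 𝟙 A := by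
  rw [P.leftUnitor_eq_π₂, κ₂_π₂]

end Prelineariser

/-! ### Lists of morphisms into sums and products -/

section MapComp

variable {C : Type u} [Category.{v} C] {ι : Type w} {X : ι → C}

/-- Postcompose every member of a list of morphisms with `f`. A morphism is recorded together with the
index `x` of its source `X x`. -/
def mapComp {Y Z : C} (f : Y ⟶ Z) (l : List (Σ x, X x ⟶ Y)) : List (Σ x, X x ⟶ Z) :=
  l.map fun p => ⟨p.1, p.2 ≫ f⟩

theorem mapComp_nil {Y Z : C} (f : Y ⟶ Z) :
    mapComp f ([] : List (Σ x, X x ⟶ Y)) = [] := rfl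

theorem mapComp_id {Y : C} (l : List (Σ x, X x ⟶ Y)) : mapComp (𝟙 Y) l = l := by
  simp [mapComp]

theorem mapComp_mapComp {Y Z W : C} (f : Y ⟶ Z) (g : Z ⟶ W) (l : List (Σ x, X x ⟶ Y)) :
    mapComp g (mapComp f l) = mapComp (f ≫ g) l := by
  simp [mapComp]

theorem mapComp_append {Y Z : C} (f : Y ⟶ Z) (l l' : List (Σ x, X x ⟶ Y)) :
    mapComp f (l ++ l') = mapComp f l ++ mapComp f l' :=
  List.map_append

theorem length_mapComp {Y Z : C} (f : Y ⟶ Z) (l : List (Σ x, X x ⟶ Y)) :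
    (mapComp f l).length = l.length :=
  List.length_map _

theorem mapComp_inv_of_mapComp_hom {Y Z : C} (e : Y ≅ Z) {l : List (Σ x, X x ⟶ Y)}
    {l' : List (Σ x, X x ⟶ Z)} (h : mapComp e.hom l = l') : mapComp e.inv l' = l := by
  rw [← h, mapComp_mapComp, e.hom_inv_id, mapComp_id]

/-- A list of morphisms with common target is jointly epimorphic. -/
def JointlyEpi {Y : C} (l : List (Σ x, X x ⟶ Y)) : Prop :=
  ∀ ⦃Z : C⦄ (f g : Y ⟶ Z), mapComp f l = mapComp g l → f = g

theorem jointlyEpi_id (x : ι) : JointlyEpi ([⟨x, 𝟙 (X x)⟩] : List (Σ y, X y ⟶ X x)) := by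
  intro Z f g h
  simpa [mapComp] using h

theorem JointlyEpi.nil_of_isInitial {Y : C} (hY : IsInitial Y) :
    JointlyEpi ([] : List (Σ x, X x ⟶ Y)) :=
  fun _ f g _ => hY.hom_ext f g

end MapComp

section SumLists

variable {C : Type u} [Category.{v} C] (S : SumStructure C) {ι : Type w} {X : ι → C}

/-- The list of morphisms into `A ⊕ B` assembled from a list of morphisms into `A` and one into `B`. -/
def SumStructure.append {A B : C} (l : List (Σ x, X x ⟶ A)) (l' : List (Σ x, X x ⟶ B)) :
    List (Σ x, X x ⟶ S.obj A B) :=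
  mapComp (S.ι₁ A B) l ++ mapComp (S.ι₂ A B) l'

namespace SumStructure

theorem jointlyEpi_append {A B : C} {l : List (Σ x, X x ⟶ A)} {l' : List (Σ x, X x ⟶ B)}
    (h : JointlyEpi l) (h' : JointlyEpi l') : JointlyEpi (S.append l l') := by
  intro Z f g e
  rw [append, mapComp_append, mapComp_append] at e
  simp only [mapComp_mapComp] at e
  obtain ⟨e₁, e₂⟩ := List.append_inj e (by rw [length_mapComp, length_mapComp])
  exact S.jointly_epi f g (h _ _ e₁) (h' _ _ e₂)

theorem mapComp_tensorHom_append {A A' B B' : C} (f : A ⟶ A') (g : B ⟶ B')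
    (l : List (Σ x, X x ⟶ A)) (l' : List (Σ x, X x ⟶ B)) :
    mapComp (letI := S.monoidal; f ⊗ₘ g) (S.append l l') =
      S.append (mapComp f l) (mapComp g l') := by
  rw [append, append, mapComp_append]
  simp only [mapComp_mapComp]
  rw [S.ι₁_tensorHom, S.ι₂_tensorHom]

theorem mapComp_associator_append {A B D : C} (l : List (Σ x, X x ⟶ A))
    (l' : List (Σ x, X x ⟶ B)) (l'' : List (Σ x, X x ⟶ D)) :
    mapComp (letI := S.monoidal; (α_ A B D).hom) (S.append (S.append l l') l'') =
      S.append l (S.append l' l'') := by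
  simp only [append, mapComp_append, List.append_assoc, mapComp_mapComp]
  rw [S.ι₁_ι₁_associator, S.ι₂_ι₁_associator, S.ι₂_associator]

theorem mapComp_leftUnitor_append {A : C} (l : List (Σ x, X x ⟶ A)) :
    mapComp (letI := S.monoidal; (λ_ A).hom) (S.append (A := S.zero) [] l) = l := by
  rw [append, mapComp_nil, List.nil_append, mapComp_mapComp, S.ι₂_leftUnitor, mapComp_id]

theorem mapComp_rightUnitor_append {A : C} (l : List (Σ x, X x ⟶ A)) :
    mapComp (letI := S.monoidal; (ρ_ A).hom) (S.append (B := S.zero) l []) = l := by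
  rw [append, mapComp_nil, List.append_nil, mapComp_mapComp, S.ι₁_rightUnitor, mapComp_id]

end SumStructure

end SumLists

section ProdLists

variable {C : Type u} [Category.{v} C] {S : SumStructure C} {P : ProductStructure C}
  {ι : Type w} {X : ι → C}

/-- The list of morphisms into `A ⊗ B` assembled from a list of morphisms into `A` and one into `B`. -/
def Prelineariser.append (L : Prelineariser S P) {A B : C} (l : List (Σ x, X x ⟶ A))
    (l' : List (Σ x, X x ⟶ B)) : List (Σ x, X x ⟶ P.obj A B) :=
  mapComp (L.κ₁ A B) l ++ mapComp (L.κ₂ A B) l'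

namespace Prelineariser

variable (L : Prelineariser S P)

theorem mapComp_i_append {A B : C} (l : List (Σ x, X x ⟶ A)) (l' : List (Σ x, X x ⟶ B)) :
    mapComp (L.i.app (A, B)) (S.append l l') = L.append l l' := by
  rw [append, SumStructure.append, mapComp_append]
  simp only [mapComp_mapComp]
  rfl

theorem mapComp_tensorHom_append {A A' B B' : C} (f : A ⟶ A') (g : B ⟶ B')
    (l : List (Σ x, X x ⟶ A)) (l' : List (Σ x, X x ⟶ B)) :
    mapComp (letI := P.monoidal; f ⊗ₘ g) (L.append l l') =
      L.append (mapComp f l) (mapComp g l') := by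
  rw [append, append, mapComp_append]
  simp only [mapComp_mapComp]
  rw [L.κ₁_tensorHom, L.κ₂_tensorHom]

theorem mapComp_associator_append {A B D : C} (l : List (Σ x, X x ⟶ A))
    (l' : List (Σ x, X x ⟶ B)) (l'' : List (Σ x, X x ⟶ D)) :
    mapComp (letI := P.monoidal; (α_ A B D).hom) (L.append (L.append l l') l'') =
      L.append l (L.append l' l'') := by
  simp only [append, mapComp_append, List.append_assoc, mapComp_mapComp, Category.assoc]
  rw [L.κ₁_κ₁_associator, L.κ₂_κ₁_associator, L.κ₂_associator]

theorem mapComp_leftUnitor_append {A : C} (l : List (Σ x, X x ⟶ A)) :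
    mapComp (letI := P.monoidal; (λ_ A).hom) (L.append (A := P.one) [] l) = l := by
  rw [append, mapComp_nil, List.nil_append, mapComp_mapComp, L.κ₂_leftUnitor, mapComp_id]

theorem mapComp_rightUnitor_append {A : C} (l : List (Σ x, X x ⟶ A)) :
    mapComp (letI := P.monoidal; (ρ_ A).hom) (L.append (B := P.one) l []) = l := by
  rw [append, mapComp_nil, List.append_nil, mapComp_mapComp, L.κ₁_rightUnitor, mapComp_id]

end Prelineariser

theorem JointlyEpi.mapComp_of_epi {Y Z : C} {l : List (Σ x, X x ⟶ Y)} (h : JointlyEpi l)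
    (e : Y ⟶ Z) [Epi e] : JointlyEpi (mapComp e l) := by
  intro W f g hfg
  rw [mapComp_mapComp, mapComp_mapComp] at hfg
  exact (cancel_epi e).1 (h _ _ hfg)

theorem Lineariser.jointlyEpi_append (L : Lineariser S P) {A B : C} {l : List (Σ x, X x ⟶ A)}
    {l' : List (Σ x, X x ⟶ B)} (h : JointlyEpi l) (h' : JointlyEpi l') :
    JointlyEpi (L.toPrelineariser.append l l') := by
  have := L.isIso
  rw [← Prelineariser.mapComp_i_append]
  exact (S.jointlyEpi_append h h').mapComp_of_epi _

end ProdLists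

/-! ### The inclusions of a word and uniqueness -/

section Inclusions

variable {C : Type u} [Category.{v} C] {S : SumStructure C} {P : ProductStructure C}
  {ι : Type w}

/-- The inclusions `X x ⟶ a(X)`, one for each occurrence of a letter `x` in the word `a`, listed from
left to right. An occurrence is recorded by its position in the list, so repeated letters are
allowed. -/
def Word.incl (L : Prelineariser S P) (X : ι → C) :
    (a : Word ι) → List (Σ x, X x ⟶ (a.toFunctor S P).obj X)
  | .var x => [⟨x, 𝟙 (X x)⟩]
  | .zero => []
  | .one => []
  | .sum a b => S.append (a.incl L X) (b.incl L X)
  | .prod a b => L.append (a.incl L X) (b.incl L X)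

/-- For a product this needs `i` to be epic, so that `κ₁, κ₂` are jointly epimorphic like `ι₁, ι₂`. -/
theorem Word.incl_jointlyEpi (L : Lineariser S P) (X : ι → C) (a : Word ι) :
    JointlyEpi (a.incl L.toPrelineariser X) := by
  induction a with
  | var x => exact jointlyEpi_id x
  | zero => exact JointlyEpi.nil_of_isInitial S.isInitial
  | one =>
    -- `0` and `1` are isomorphic, so `1` is initial as well.
    have e : S.zero ≅ P.one :=
      ⟨S.isInitial.to P.one, oneToZero L.i, S.isInitial.hom_ext _ _, P.isTerminal.hom_ext _ _⟩
    exact JointlyEpi.nil_of_isInitial (S.isInitial.ofIso e)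
  | sum a b iha ihb => exact S.jointlyEpi_append iha ihb
  | prod a b iha ihb => exact L.jointlyEpi_append iha ihb

/-- A canonical transformation carries the inclusions of its source to those of its target. -/
theorem Lineariser.IsCanonical.mapComp_incl {L : Lineariser S P} {a b : Word ι}
    {β : a.toFunctor S P ⟶ b.toFunctor S P} (h : L.IsCanonical a b β) (X : ι → C) :
    mapComp (β.app X) (a.incl L.toPrelineariser X) = b.incl L.toPrelineariser X := by
  have := L.isIso
  induction h with
  | i a b => exact L.mapComp_i_append _ _
  | i_inv a b =>
    have e := mapComp_inv_of_mapComp_hom ((asIso L.i).app (_, _))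
      (L.mapComp_i_append (a.incl L.toPrelineariser X) (b.incl L.toPrelineariser X))
    exact e
  | j => rfl
  | id a => exact mapComp_id _
  | sum_α_hom a b c => exact S.mapComp_associator_append _ _ _
  | sum_α_inv a b c =>
    exact mapComp_inv_of_mapComp_hom (letI := S.monoidal; α_ _ _ _)
      (S.mapComp_associator_append _ _ _)
  | sum_lam_hom a => exact S.mapComp_leftUnitor_append _
  | sum_lam_inv a =>
    exact mapComp_inv_of_mapComp_hom (letI := S.monoidal; λ_ _) (S.mapComp_leftUnitor_append _)
  | sum_ρ_hom a => exact S.mapComp_rightUnitor_append _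
  | sum_ρ_inv a =>
    exact mapComp_inv_of_mapComp_hom (letI := S.monoidal; ρ_ _) (S.mapComp_rightUnitor_append _)
  | prod_α_hom a b c => exact L.mapComp_associator_append _ _ _
  | prod_α_inv a b c =>
    exact mapComp_inv_of_mapComp_hom (letI := P.monoidal; α_ _ _ _)
      (L.mapComp_associator_append _ _ _)
  | prod_lam_hom a => exact L.mapComp_leftUnitor_append _
  | prod_lam_inv a =>
    exact mapComp_inv_of_mapComp_hom (letI := P.monoidal; λ_ _) (L.mapComp_leftUnitor_append _)
  | prod_ρ_hom a => exact L.mapComp_rightUnitor_append _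
  | prod_ρ_inv a =>
    exact mapComp_inv_of_mapComp_hom (letI := P.monoidal; ρ_ _) (L.mapComp_rightUnitor_append _)
  | comp _ _ ihβ ihγ => rw [NatTrans.comp_app, ← mapComp_mapComp, ihβ, ihγ]
  | sum _ _ ihβ ihγ =>
    exact (S.mapComp_tensorHom_append _ _ _ _).trans (congrArg₂ _ ihβ ihγ)
  | prod _ _ ihβ ihγ =>
    exact (L.mapComp_tensorHom_append _ _ _ _).trans (congrArg₂ _ ihβ ihγ)

/-- Canonical transformations between two given words are unique, already on components. The words may
have repeated letters. -/
theorem Lineariser.IsCanonical.app_eq {L : Lineariser S P} {a b : Word ι}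
    {β γ : a.toFunctor S P ⟶ b.toFunctor S P} (hβ : L.IsCanonical a b β)
    (hγ : L.IsCanonical a b γ) (X : ι → C) : β.app X = γ.app X :=
  a.incl_jointlyEpi L X _ _ ((hβ.mapComp_incl X).trans (hγ.mapComp_incl X).symm)

end Inclusions

/-! ### Normal forms and existence -/

section Existence

variable {C : Type u} [Category.{v} C] {S : SumStructure C} {P : ProductStructure C}
  {ι : Type w}

/-- Two words are canonically isomorphic if there is a natural isomorphism between their functors
which is canonical in both directions. -/
def Lineariser.CanonicallyIso (L : Lineariser S P) (a b : Word ι) : Prop :=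
  ∃ e : a.toFunctor S P ≅ b.toFunctor S P, L.IsCanonical a b e.hom ∧ L.IsCanonical b a e.inv

/-- The letters of a word, from left to right. -/
def Word.letters : Word ι → List ι
  | .var x => [x]
  | .zero => []
  | .one => []
  | .sum a b => a.letters ++ b.letters
  | .prod a b => a.letters ++ b.letters

/-- The right-bracketed sum `x₁ ⊕ (x₂ ⊕ ⋯ (xₙ ⊕ 0))` of a list of letters. -/
def Word.ofList : List ι → Word ι
  | [] => .zero
  | x :: l => .sum (.var x) (ofList l)

namespace Lineariser.CanonicallyIso

variable {L : Lineariser S P} {a a' b b' c : Word ι}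

theorem refl (a : Word ι) : L.CanonicallyIso a a :=
  ⟨Iso.refl _, .id a, .id a⟩

theorem symm : L.CanonicallyIso a b → L.CanonicallyIso b a
  | ⟨e, h, h'⟩ => ⟨e.symm, h', h⟩

theorem trans : L.CanonicallyIso a b → L.CanonicallyIso b c → L.CanonicallyIso a c
  | ⟨e, h, h'⟩, ⟨f, k, k'⟩ => ⟨e ≪≫ f, h.comp k, k'.comp h'⟩

theorem sum : L.CanonicallyIso a a' → L.CanonicallyIso b b' →
    L.CanonicallyIso (.sum a b) (.sum a' b')
  | ⟨e, h, h'⟩, ⟨f, k, k'⟩ => ⟨letI := S.monoidal; e ⊗ᵢ f, h.sum k, h'.sum k'⟩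

theorem sum_associator (a b c : Word ι) :
    L.CanonicallyIso (.sum (.sum a b) c) (.sum a (.sum b c)) :=
  ⟨letI := S.monoidal; α_ (a.toFunctor S P) (b.toFunctor S P) (c.toFunctor S P),
    .sum_α_hom a b c, .sum_α_inv a b c⟩

theorem sum_zero_left (a : Word ι) : L.CanonicallyIso (.sum .zero a) a :=
  ⟨letI := S.monoidal; λ_ (a.toFunctor S P), .sum_lam_hom a, .sum_lam_inv a⟩

theorem sum_zero_right (a : Word ι) : L.CanonicallyIso (.sum a .zero) a :=
  ⟨letI := S.monoidal; ρ_ (a.toFunctor S P), .sum_ρ_hom a, .sum_ρ_inv a⟩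

theorem prod_one_left (a : Word ι) : L.CanonicallyIso (.prod .one a) a :=
  ⟨letI := P.monoidal; λ_ (a.toFunctor S P), .prod_lam_hom a, .prod_lam_inv a⟩

theorem sum_prod (a b : Word ι) : L.CanonicallyIso (.sum a b) (.prod a b) :=
  have := L.isIso
  ⟨Functor.isoWhiskerLeft ((a.toFunctor S P).prod' (b.toFunctor S P)) (asIso L.i),
    .i a b, .i_inv a b⟩

/-- The composite `1 ≅ 1 ⊕ 0 ≅ 1 ⊗ 0 ≅ 0`. -/
theorem one_zero : L.CanonicallyIso (.one : Word ι) .zero :=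
  (sum_zero_right .one).symm.trans ((sum_prod _ _).trans (prod_one_left _))

theorem ofList_append (l l' : List ι) :
    L.CanonicallyIso (.sum (.ofList l) (.ofList l')) (.ofList (l ++ l')) := by
  induction l with
  | nil => exact sum_zero_left _
  | cons x l ih => exact (sum_associator _ _ _).trans ((refl _).sum ih)

theorem ofList_letters (a : Word ι) : L.CanonicallyIso a (.ofList a.letters) := by
  induction a with
  | var x => exact (sum_zero_right _).symm
  | zero => exact refl _
  | one => exact one_zero
  | sum a b iha ihb => exact (iha.sum ihb).trans (ofList_append _ _)
  | prod a b iha ihb =>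
    exact (sum_prod a b).symm.trans ((iha.sum ihb).trans (ofList_append _ _))

theorem of_letters_eq (h : a.letters = b.letters) : L.CanonicallyIso a b :=
  (ofList_letters a).trans (h ▸ (ofList_letters b).symm)

end Lineariser.CanonicallyIso

theorem SumProdWord.letters_fill (a : SumProdWord) (x : Fin (SumProdWord.length a) → ι) :
    (a.fill x).letters = List.ofFn x := by
  induction a with
  | var _ => exact (List.ofFn_succ (f := x)).symm
  | zero => exact (List.ofFn_zero (f := x)).symm
  | one => exact (List.ofFn_zero (f := x)).symm
  | sum a b iha ihb =>
    exact (congrArg₂ _ (iha _) (ihb _)).trans (List.ofFn_add (f := x)).symm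
  | prod a b iha ihb =>
    exact (congrArg₂ _ (iha _) (ihb _)).trans (List.ofFn_add (f := x)).symm

theorem SumProdWord.letters_numbered (a : SumProdWord) {n : ℕ}
    (h : SumProdWord.length a = n) : (a.numbered h).letters = List.finRange n := by
  subst h
  rw [numbered, letters_fill, ← List.ofFn_id]
  rfl

end Existence

theorem mainTheorem2 {C : Type u} [Category.{v} C] (S : SumStructure C) (P : ProductStructure C)
    (L : Lineariser S P) {n : ℕ} (a b : SumProdWord)
    (ha : SumProdWord.length a = n) (hb : SumProdWord.length b = n) :
    (∃! e : SumProdWord.toFunctor S P a ha ≅ SumProdWord.toFunctor S P b hb,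
      L.IsCanonical (a.numbered ha) (b.numbered hb) e.hom) ∧
    (∀ X : Fin n → C,
      ∃! f : (SumProdWord.toFunctor S P a ha).obj X ≅ (SumProdWord.toFunctor S P b hb).obj X,
        ∃ β : SumProdWord.toFunctor S P a ha ⟶ SumProdWord.toFunctor S P b hb,
          L.IsCanonical (a.numbered ha) (b.numbered hb) β ∧ f.hom = β.app X) := by
  obtain ⟨e, he, -⟩ := Lineariser.CanonicallyIso.of_letters_eq (L := L)
    ((a.letters_numbered ha).trans (b.letters_numbered hb).symm)
  refine ⟨⟨e, he, fun e' he' => ?_⟩, fun X => ⟨e.app X, ⟨e.hom, he, rfl⟩, ?_⟩⟩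
  · ext X
    exact he'.app_eq he X
  · rintro f ⟨β, hβ, hf⟩
    ext
    exact hf.trans (hβ.app_eq he X)
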